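/- Conventions. Let $\Gamma=(m_{i,j})_{i,j\in I}$ be a Coxeter matrix over an arbitrary (possibly infinite) set $I$, with entries in $\mathbb N_{\ge 1}\cup\{\infty\}$, let $W_\Gamma=\langle s_i\ (i\in I)\mid (s_is_j)^{m_{i,j}}=1 \text{ if } m_{i,j}\ne\infty\rangle$ be its Coxeter group with standard length $\ell$, and let $B^+_\Gamma$ be its Artin–Tits monoid, presented by generators $\mathbf s_i$ $(i\in I)$ and the relations $\prod_{m_{i,j}}(\mathbf s_i,\mathbf s_j)=\prod_{m_{i,j}}(\mathbf s_j,\mathbf s_i)$ for $m_{i,j}\neq\infty$, where $\prod_n(x,y)=xyxy\cdots$ ($n$ factors). For $w\in W_\Gamma$ let $\mathbf w\in B^+_\Gamma$ be the element represented by any reduced word of $w$. For $J\subseteq I$ set $\Gamma_J=(m_{i,j})_{i,j\in J}$ and $W_J=\langle s_j\mid j\in J\rangle$; $J$ (or $\Gamma_J$) is spherical if $W_J$ is finite, and then $r_J$ is the unique element of maximal length of $W_J$ and $\mathbf r_J$ is its image in $B^+_\Gamma$. Partitions have non-empty blocks. A partition $\tilde I$ of $I$ is spherical if all its blocks are spherical;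 its type is then $\tilde\Gamma=(|r_\alpha r_\beta|)_{\alpha,\beta\in\tilde I}$, where $|\cdot|$ is the order in $W_\Gamma$. A spherical partition $\tilde I$ is an admissible partition of $\Gamma$ if for every $w\in\langle r_\alpha\mid\alpha\in\tilde I\rangle$ and every $\alpha\in\tilde I$, either $\ell(ws_i)=\ell(w)+1$ for all $i\in\alpha$, or $\ell(ws_i)=\ell(w)-1$ for all $i\in\alpha$. Given a Coxeter matrix $\Omega=(n_{\alpha,\beta})_{\alpha,\beta\in\tilde I}$ over a spherical partition $\tilde I$, one says that $\tilde I$ is an LCM-partition of $\Gamma$ of type $\Omega$ if for each $(\alpha,\beta)\in\tilde I^2$ one of the following holds: (Fi) $n_{\alpha,\beta}\ne\infty$, $\Gamma_{\alpha\cup\beta}$ is spherical, and $\mathbf r_{\alpha\cup\beta}=\prod_{n_{\alpha,\beta}}(\mathbf r_\alpha,\mathbf r_\beta)$; (In) $n_{\alpha,\beta}=\infty$ and $\Gamma_{\{i\}\cup\beta}$ is non-spherical for all $i\in\alpha$. For $J\subseteq I$ and an LCM-partition $\tilde J$ of $\Gamma_J$ of type $\Omega$, the monoid homomorphism $B^+_\Omega\to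 B^+_\Gamma$ with $\mathbf s_\alpha\mapsto\mathbf r_\alpha$ $(\alpha\in\tilde J)$ is called an LCM-homomorphism. For an admissible partition $\tilde J$ of $\Gamma_J$ of type $\tilde\Gamma$, the monoid homomorphism $B^+_{\tilde\Gamma}\to B^+_\Gamma$ with $\mathbf s_\alpha\mapsto\mathbf r_\alpha$ $(\alpha\in\tilde J)$ is called an admissible morphism. Theorem. Let $\Gamma$ be a Coxeter matrix over a set $I$, and let $\tilde I$ be an LCM-partition of $\Gamma$, of type $\Omega$. Then $\tilde I$ is an admissible partition of $\Gamma$, and $\Omega=\tilde\Gamma=(|r_\alpha r_\beta|)_{\alpha,\beta\in\tilde I}$. Hence every LCM-homomorphism into $B^+_\Gamma$ is an admissible morphism (induced by the same partition $\tilde J$ of the same $J\subseteq I$). -/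

import Mathlib

namespace CoxeterMatrix

/-- The alternating product `x * y * x * y * ⋯` with `n` factors, starting with `x`. -/
def altProd {A : Type*} [Monoid A] : ℕ → A → A → A
  | 0, _, _ => 1
  | n + 1, x, y => x * altProd n y x

/-- The submatrix `Γ_J = (m_{i,j})_{i,j ∈ J}` of a Coxeter matrix. -/
def restrict {I : Type*} (M : CoxeterMatrix I) (J : Set I) : CoxeterMatrix J where
  M := Matrix.of fun i j => M i j
  isSymm := Matrix.IsSymm.ext fun i j => M.symmetric j i
  diagonal i := M.diagonal i
  off_diagonal i j h := M.off_diagonal i j fun e => h (Subtype.ext e)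

/-- The braid relations `s_i s_j s_i ⋯ = s_j s_i s_j ⋯` (`m_{i,j}` factors on each side) for all
`i, j` with `m_{i,j}` finite.  In Mathlib's Coxeter matrices the entry `0` stands for `∞`. -/
def BraidRel {I : Type*} (M : CoxeterMatrix I) (x y : FreeMonoid I) : Prop :=
  ∃ i j : I, M i j ≠ 0 ∧
    x = altProd (M i j) (FreeMonoid.of i) (FreeMonoid.of j) ∧
    y = altProd (M i j) (FreeMonoid.of j) (FreeMonoid.of i)

/-- The Artin-Tits monoid `B⁺_Γ`. -/
abbrev ArtinMonoid {I : Type*} (M : CoxeterMatrix I) : Type _ := PresentedMonoid M.BraidRel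

/-- The standard generator of the Artin-Tits monoid with index `i`. -/
def artinGen {I : Type*} (M : CoxeterMatrix I) (i : I) : M.ArtinMonoid :=
  PresentedMonoid.of M.BraidRel i

/-- The standard length on the Coxeter group `W_Γ`. -/
noncomputable def len {I : Type*} (M : CoxeterMatrix I) (w : M.Group) : ℕ :=
  M.toCoxeterSystem.length w

/-- The image `𝐰 ∈ B⁺_Γ` of `w ∈ W_Γ` under the canonical section: the element of the Artin-Tits
monoid represented by a reduced word of `w` (all reduced words of `w` represent the same one). -/
noncomputable def toArtin {I : Type*} (M : CoxeterMatrix I) (w : M.Group) : M.ArtinMonoid :=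
  ((M.toCoxeterSystem.exists_isReduced w).choose.map M.artinGen).prod

/-- The standard parabolic subgroup `W_J` of the Coxeter group `W_Γ`. -/
def parabolic {I : Type*} (M : CoxeterMatrix I) (J : Set I) : Subgroup M.Group :=
  Subgroup.closure (M.simple '' J)

/-- The subset `J` is spherical: `W_J` is finite. -/
def IsSpherical {I : Type*} (M : CoxeterMatrix I) (J : Set I) : Prop :=
  Finite (M.parabolic J)

/-- The (unique) element `r_J` of maximal standard length in `W_J`, for `J` spherical. -/
noncomputable def longest {I : Type*} (M : CoxeterMatrix I) (J : Set I) : M.Group :=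
  Classical.epsilon fun w => w ∈ M.parabolic J ∧ ∀ v ∈ M.parabolic J, M.len v ≤ M.len w

/-- The image `𝐫_J ∈ B⁺_Γ` of `r_J` under the canonical section, for `J` spherical. -/
noncomputable def artinLongest {I : Type*} (M : CoxeterMatrix I) (J : Set I) : M.ArtinMonoid :=
  M.toArtin (M.longest J)

/-- `P` is a spherical partition of `Γ`: a partition of `I` into (non-empty) spherical subsets. -/
def IsSphericalPartition {I : Type*} (M : CoxeterMatrix I) (P : Set (Set I)) : Prop :=
  Setoid.IsPartition P ∧ ∀ α ∈ P, M.IsSpherical α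

/-- The type `(|r_α r_β|)_{α, β ∈ P}` of a spherical partition `P`.  Both `orderOf` and Mathlib's
Coxeter matrices use the value `0` for `∞`. -/
noncomputable def partitionType {I : Type*} (M : CoxeterMatrix I) (P : Set (Set I)) :
    Matrix P P ℕ :=
  Matrix.of fun α β => orderOf (M.longest (α : Set I) * M.longest (β : Set I))

/-- The set `I⁺(w)` of all `i` with `ℓ(w s_i) = ℓ(w) + 1`. -/
def ascents {I : Type*} (M : CoxeterMatrix I) (w : M.Group) : Set I :=
  {i | M.len (w * M.simple i) = M.len w + 1}

/-- The set `I⁻(w)` of all `i` with `ℓ(w s_i) = ℓ(w) - 1`. -/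
def descents {I : Type*} (M : CoxeterMatrix I) (w : M.Group) : Set I :=
  {i | M.len (w * M.simple i) + 1 = M.len w}

/-- `P` is an admissible partition of `Γ`: a spherical partition such that, for every `w` in the
subgroup generated by the `r_α` (`α ∈ P`) and every `α ∈ P`, either `α ⊆ I⁺(w)` or `α ⊆ I⁻(w)`. -/
def IsAdmissiblePartition {I : Type*} (M : CoxeterMatrix I) (P : Set (Set I)) : Prop :=
  M.IsSphericalPartition P ∧
    ∀ w ∈ Subgroup.closure (M.longest '' P), ∀ α ∈ P, α ⊆ M.ascents w ∨ α ⊆ M.descents w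

/-- `P` is an LCM-partition of `Γ` of type `Ω`, a Coxeter matrix over `P`. -/
def IsLCMPartition {I : Type*} (M : CoxeterMatrix I) (P : Set (Set I)) (Ω : CoxeterMatrix P) :
    Prop :=
  M.IsSphericalPartition P ∧ ∀ α β : P,
    (Ω α β ≠ 0 ∧ M.IsSpherical ((α : Set I) ∪ β) ∧
      M.artinLongest ((α : Set I) ∪ β) =
        altProd (Ω α β) (M.artinLongest (α : Set I)) (M.artinLongest (β : Set I))) ∨
    (Ω α β = 0 ∧ ∀ i ∈ (α : Set I), ¬ M.IsSpherical ({i} ∪ (β : Set I)))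

/-- `φ : B⁺_Ω → B⁺_Γ` is an LCM-homomorphism: `Ω` is a Coxeter matrix over an LCM-partition `P`,
of type `Ω`, of `Γ_J` for a subset `J` of `I`, and `φ` sends each generator `s_α` to `𝐫_α`. -/
def IsLCMHomomorphism {I : Type*} (M : CoxeterMatrix I) {J : Set I} {P : Set (Set J)}
    {Ω : CoxeterMatrix P} (φ : Ω.ArtinMonoid →* M.ArtinMonoid) : Prop :=
  (M.restrict J).IsLCMPartition P Ω ∧
    ∀ α : P, φ (Ω.artinGen α) = M.artinLongest (Subtype.val '' (α : Set J))

/-- `φ : B⁺_Ω → B⁺_Γ` is an admissible morphism: `Ω` is the type of an admissible partition `P`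
of `Γ_J` for a subset `J` of `I`, and `φ` sends each generator `s_α` to `𝐫_α`. -/
def IsAdmissibleMorphism {I : Type*} (M : CoxeterMatrix I) {J : Set I} {P : Set (Set J)}
    {Ω : CoxeterMatrix P} (φ : Ω.ArtinMonoid →* M.ArtinMonoid) : Prop :=
  (M.restrict J).IsAdmissiblePartition P ∧ Ω.M = (M.restrict J).partitionType P ∧
    ∀ α : P, φ (Ω.artinGen α) = M.artinLongest (Subtype.val '' (α : Set J))

end CoxeterMatrix

/-! The relation `s_α ↦ r_α` induces a morphism `φ` of Coxeter groups, because in case (Fi) the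
element `r_{α∪β}` is an alternating product of `r_α` and `r_β` in either order. The heart is
`IsLCMPartition.subset_ascents_groupHom`: if `α` is an ascent of `u`, then every `i ∈ α` is an
ascent of `φ(u)`. Replacing `u` by `u s_α` gives the dual statement for descents, hence
admissibility.

The dihedral case is `IsLCMPartition.subset_ascents_inv_altProd`. In case (Fi), lengths add in the
alternating product equal to `r_{α∪β}`, hence in all shorter ones. In case (In), if an element has
all of `β` and some `i ∈ α` as descents, then `{i} ∪ β` is spherical
(`isSpherical_of_subset_descents`), which is excluded.

The general case is an induction on length: write `u = v x` with `x` in a dihedral parabolic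
subgroup and `v` of minimal length in its coset. By induction `α ∪ β` consists of ascents of `φ(v)`,
so lengths add on `φ(v) W_{α∪β}`, and the dihedral case for `x` concludes. The order of `r_α r_β`
also follows from the dihedral case: an earlier relation would make `α` consist of both ascents and
descents of one element. -/

namespace CoxeterSystem

/-! ### The exchange condition, by a signed action on `W × ZMod 2` -/

variable {B W : Type*} [Group W] {M : CoxeterMatrix B} (cs : CoxeterSystem M W)

open scoped Classical in
/-- The involution `(t, ε) ↦ (s_i t s_i, ε + [t = s_i])` of `W × ZMod 2`. -/
noncomputable def signedConj (i : B) : Equiv.Perm (W × ZMod 2) :=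
  Function.Involutive.toPerm
    (fun p => (cs.simple i * p.1 * cs.simple i, p.2 + if p.1 = cs.simple i then 1 else 0)) <| by
      rintro ⟨t, e⟩
      have h : cs.simple i * t * cs.simple i = cs.simple i ↔ t = cs.simple i := by
        constructor
        · intro h
          have := congrArg (fun x => cs.simple i * x) (mul_eq_right.mp h)
          simpa [← mul_assoc] using this
        · rintro rfl; simp
      ext
      · simp [mul_assoc]
      · simp only [h]
        split_ifs
        · rw [add_assoc, CharTwo.add_self_eq_zero, add_zero]
        · simp

open scoped Classical in
theorem signedConj_apply (i : B) (t : W) (e : ZMod 2) :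
    cs.signedConj i (t, e) =
      (cs.simple i * t * cs.simple i, e + if t = cs.simple i then 1 else 0) := rfl

open scoped Classical in
theorem signedConj_mul_pow_apply (i j : B) (k : ℕ) (t : W) (e : ZMod 2) :
    ((cs.signedConj i * cs.signedConj j) ^ k) (t, e) =
      ((cs.simple i * cs.simple j) ^ k * t * ((cs.simple i * cs.simple j) ^ k)⁻¹,
        e + ∑ l ∈ Finset.range (2 * k),
          if t = cs.simple j * (cs.simple i * cs.simple j) ^ l then 1 else 0) := by
  set r := cs.simple i * cs.simple j with hr
  -- Conjugation by `s_j` inverts the rotation `r`.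
  have hconj : ∀ k : ℕ, cs.simple j * r ^ k = (r ^ k)⁻¹ * cs.simple j := by
    intro k
    induction k with
    | zero => simp
    | succ k ih =>
      rw [pow_succ, ← mul_assoc, ih, mul_assoc, ← pow_succ, pow_succ', mul_inv_rev, mul_assoc]
      congr 1
      simp [hr, mul_assoc]
  induction k with
  | zero => simp
  | succ k ih =>
    rw [pow_succ', Equiv.Perm.mul_apply, ih, Equiv.Perm.mul_apply, signedConj_apply,
      signedConj_apply]
    have h1 : r ^ k * t * (r ^ k)⁻¹ = cs.simple j ↔ t = cs.simple j * r ^ (2 * k) := by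
      rw [mul_inv_eq_iff_eq_mul, hconj, two_mul, pow_add, ← mul_assoc (cs.simple j), hconj,
        mul_assoc, hconj, ← eq_inv_mul_iff_mul_eq]
    have h2 : cs.simple j * (r ^ k * t * (r ^ k)⁻¹) * cs.simple j = cs.simple i ↔
        t = cs.simple j * r ^ (2 * k + 1) := by
      have e1 : cs.simple j * (r ^ k * t * (r ^ k)⁻¹) * cs.simple j = cs.simple i ↔
          r ^ k * t * (r ^ k)⁻¹ = cs.simple j * r := by
        constructor
        · intro h
          rw [hr, ← mul_assoc, ← mul_inv_eq_iff_eq_mul, inv_simple,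
            ← mul_left_cancel_iff (a := cs.simple j)]
          simpa [mul_assoc] using h
        · intro h
          rw [h, hr]; simp [mul_assoc]
      rw [e1, mul_inv_eq_iff_eq_mul, mul_assoc, ← pow_succ', ← eq_inv_mul_iff_mul_eq, hconj, hconj,
        ← mul_assoc, ← mul_inv_rev, ← pow_add]
      congr! 4
      ring
    simp only [h1, h2]
    ext
    · simp [hr, pow_succ', mul_assoc]
    · simp only [Nat.mul_succ, Finset.sum_range_succ, add_assoc]

/-- After `m = M i j` steps the sum has `2m` terms and, since `r ^ m = 1`, its two halves coincide
and cancel mod 2. -/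
theorem isLiftable_signedConj : M.IsLiftable cs.signedConj := by
  classical
  intro i j
  ext1 ⟨t, e⟩
  rw [signedConj_mul_pow_apply, simple_mul_simple_pow, two_mul, Finset.sum_range_add]
  simp only [pow_add, simple_mul_simple_pow, one_mul, CharTwo.add_self_eq_zero]
  simp

-- Since the action factors through `W`, the parity of the number of occurrences of `t` in the
-- inversion sequence depends only on the element, not on the word.
open scoped Classical in
theorem lift_signedConj_wordProd (ω : List B) (t : W) (e : ZMod 2) :
    cs.lift ⟨_, cs.isLiftable_signedConj⟩ (cs.wordProd ω) (t, e) =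
      (cs.wordProd ω * t * (cs.wordProd ω)⁻¹, e + ((cs.rightInvSeq ω).count t : ℕ)) := by
  induction ω with
  | nil => simp
  | cons i ω ih =>
    rw [wordProd_cons, map_mul, Equiv.Perm.mul_apply, ih, lift_apply_simple, signedConj_apply,
      rightInvSeq, List.count_cons]
    have h : cs.wordProd ω * t * (cs.wordProd ω)⁻¹ = cs.simple i ↔
        (cs.wordProd ω)⁻¹ * cs.simple i * cs.wordProd ω = t := by
      constructor
      · rintro h; rw [← h]; group
      · rintro rfl; group
    ext
    · simp [mul_assoc]
    · simp only [h, beq_iff_eq, add_assoc, Nat.cast_add, Nat.cast_ite, Nat.cast_one, Nat.cast_zero]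

/-- The exchange condition. -/
theorem exists_mul_simple_eq_wordProd_eraseIdx {ω : List B} {i : B}
    (h : cs.IsRightDescent (cs.wordProd ω) i) :
    ∃ j < ω.length, cs.wordProd ω * cs.simple i = cs.wordProd (ω.eraseIdx j) := by
  classical
  obtain ⟨ω', hω', he⟩ := cs.exists_isReduced (cs.wordProd ω * cs.simple i)
  have hw : cs.wordProd ω = cs.wordProd (ω' ++ [i]) := by
    rw [wordProd_append, ← he]; simp
  have hred : cs.IsReduced (ω' ++ [i]) := by
    rw [IsReduced, ← hw, List.length_append, ← hω'.eq, ← he]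
    exact ((cs.isRightDescent_iff).mp h).symm
  have hmem : cs.simple i ∈ cs.rightInvSeq (ω' ++ [i]) := by
    rw [← List.concat_eq_append, rightInvSeq_concat]; simp
  -- In a reduced word ending in `i` the reflection `s_i` is counted once; by parity it must also
  -- occur for `ω`, and its position there is the letter to delete.
  have hcount : (cs.rightInvSeq (ω' ++ [i])).count (cs.simple i) = 1 :=
    List.count_eq_one_of_mem hred.nodup_rightInvSeq hmem
  have h1 := cs.lift_signedConj_wordProd ω (cs.simple i) 0
  rw [hw, lift_signedConj_wordProd, hcount] at h1
  have h2 := congrArg Prod.snd h1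
  simp only [zero_add] at h2
  have hmem' : cs.simple i ∈ cs.rightInvSeq ω := by
    by_contra hn
    rw [List.count_eq_zero_of_not_mem hn] at h2
    simp at h2
  obtain ⟨j, hj, hji⟩ := List.mem_iff_getElem.mp hmem'
  refine ⟨j, by simpa using hj, ?_⟩
  rw [← wordProd_mul_getD_rightInvSeq, List.getD_eq_getElem _ _ hj, hji]

end CoxeterSystem

/-! ### Lengths, ascents and descents relative to standard parabolic subgroups -/

namespace CoxeterMatrix

variable {I : Type*} (M : CoxeterMatrix I)

theorem len_one : M.len 1 = 0 := M.toCoxeterSystem.length_one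

theorem len_eq_zero_iff {w : M.Group} : M.len w = 0 ↔ w = 1 :=
  M.toCoxeterSystem.length_eq_zero_iff

theorem len_inv (w : M.Group) : M.len w⁻¹ = M.len w := M.toCoxeterSystem.length_inv w

theorem len_mul_le (v w : M.Group) : M.len (v * w) ≤ M.len v + M.len w :=
  M.toCoxeterSystem.length_mul_le v w

theorem len_wordProd_le (ω : List I) : M.len (M.toCoxeterSystem.wordProd ω) ≤ ω.length :=
  M.toCoxeterSystem.length_wordProd_le ω

theorem simple_mul_self (i : I) : M.simple i * M.simple i = 1 :=
  M.toCoxeterSystem.simple_mul_simple_self i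

theorem len_mul_simple (w : M.Group) (i : I) :
    M.len (w * M.simple i) = M.len w + 1 ∨ M.len (w * M.simple i) + 1 = M.len w :=
  M.toCoxeterSystem.length_mul_simple w i

theorem mem_ascents {w : M.Group} {i : I} :
    i ∈ M.ascents w ↔ M.len (w * M.simple i) = M.len w + 1 := Iff.rfl

theorem mem_descents {w : M.Group} {i : I} :
    i ∈ M.descents w ↔ M.len (w * M.simple i) + 1 = M.len w := Iff.rfl

theorem mem_ascents_or_mem_descents (w : M.Group) (i : I) :
    i ∈ M.ascents w ∨ i ∈ M.descents w := M.len_mul_simple w i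

theorem notMem_descents_of_mem_ascents {w : M.Group} {i : I} (h : i ∈ M.ascents w) :
    i ∉ M.descents w := by
  rw [mem_ascents] at h
  rw [mem_descents]
  omega

theorem mem_ascents_one (i : I) : i ∈ M.ascents 1 := by
  rcases M.mem_ascents_or_mem_descents 1 i with h | h
  · exact h
  · rw [mem_descents, len_one] at h
    omega

theorem wordProd_concat_simple (ω : List I) (i : I) :
    M.toCoxeterSystem.wordProd (ω ++ [i]) = M.toCoxeterSystem.wordProd ω * M.simple i := by
  rw [CoxeterSystem.wordProd_append, CoxeterSystem.wordProd_singleton,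
    toCoxeterSystem_simple]

theorem wordProd_cons_simple (ω : List I) (i : I) :
    M.toCoxeterSystem.wordProd (i :: ω) = M.simple i * M.toCoxeterSystem.wordProd ω := by
  rw [CoxeterSystem.wordProd_cons, toCoxeterSystem_simple]

theorem exists_eraseIdx_of_mem_descents {ω : List I} {i : I}
    (h : i ∈ M.descents (M.toCoxeterSystem.wordProd ω)) :
    ∃ j < ω.length, M.toCoxeterSystem.wordProd ω * M.simple i =
      M.toCoxeterSystem.wordProd (ω.eraseIdx j) := by
  rw [mem_descents] at h
  have h' : M.toCoxeterSystem.IsRightDescent (M.toCoxeterSystem.wordProd ω) i := by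
    rw [CoxeterSystem.IsRightDescent, toCoxeterSystem_simple]
    change M.len _ < M.len _
    omega
  simpa only [toCoxeterSystem_simple] using
    M.toCoxeterSystem.exists_mul_simple_eq_wordProd_eraseIdx h'

theorem wordProd_mem_parabolic {J : Set I} {ω : List I} (h : ∀ i ∈ ω, i ∈ J) :
    M.toCoxeterSystem.wordProd ω ∈ M.parabolic J := by
  induction ω with
  | nil => simp [one_mem]
  | cons i ω ih =>
    rw [wordProd_cons_simple]
    exact mul_mem (Subgroup.subset_closure ⟨i, h i (by simp), rfl⟩)
      (ih fun j hj => h j (by simp [hj]))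

theorem simple_mem_parabolic {J : Set I} {i : I} (hi : i ∈ J) : M.simple i ∈ M.parabolic J :=
  Subgroup.subset_closure ⟨i, hi, rfl⟩

theorem parabolic_mono {J K : Set I} (h : J ⊆ K) : M.parabolic J ≤ M.parabolic K :=
  Subgroup.closure_mono (Set.image_mono h)

/-- Every element of a standard parabolic subgroup has a reduced word in its generators. -/
theorem exists_isReduced_of_mem_parabolic {J : Set I} {w : M.Group} (hw : w ∈ M.parabolic J) :
    ∃ ω : List I, (∀ i ∈ ω, i ∈ J) ∧ M.toCoxeterSystem.IsReduced ω ∧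
      M.toCoxeterSystem.wordProd ω = w := by
  have key : ∀ w : M.Group, (∃ ω : List I, (∀ i ∈ ω, i ∈ J) ∧ M.toCoxeterSystem.IsReduced ω ∧
      M.toCoxeterSystem.wordProd ω = w) → ∀ i ∈ J, ∃ ω : List I, (∀ i ∈ ω, i ∈ J) ∧
      M.toCoxeterSystem.IsReduced ω ∧ M.toCoxeterSystem.wordProd ω = w * M.simple i := by
    rintro w ⟨ω, hJ, hr, rfl⟩ i hi
    have hr' : M.len (M.toCoxeterSystem.wordProd ω) = ω.length := hr
    rcases M.mem_ascents_or_mem_descents (M.toCoxeterSystem.wordProd ω) i with h | h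
    · refine ⟨ω ++ [i], ?_, ?_, M.wordProd_concat_simple ω i⟩
      · intro j hj
        rcases List.mem_append.mp hj with hj | hj
        · exact hJ j hj
        · rw [List.mem_singleton.mp hj]; exact hi
      · rw [mem_ascents] at h
        change M.len _ = _
        rw [wordProd_concat_simple, h, hr']
        simp
    · obtain ⟨j, hj, he⟩ := M.exists_eraseIdx_of_mem_descents h
      refine ⟨ω.eraseIdx j, fun k hk => hJ k (List.mem_of_mem_eraseIdx hk), ?_, he.symm⟩
      rw [mem_descents, he, hr'] at h
      change M.len _ = _
      have := List.length_eraseIdx_add_one hj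
      omega
  refine Subgroup.closure_induction_right (p := fun w _ => ∃ ω : List I, (∀ i ∈ ω, i ∈ J) ∧
    M.toCoxeterSystem.IsReduced ω ∧ M.toCoxeterSystem.wordProd ω = w) ?_ ?_ ?_ hw
  · exact ⟨[], by simp, M.len_one, by simp⟩
  · rintro w _ _ ⟨i, hi, rfl⟩ ih
    exact key w ih i hi
  · rintro w _ _ ⟨i, hi, rfl⟩ ih
    rw [inv_eq_of_mul_eq_one_left (M.simple_mul_self i)]
    exact key w ih i hi

/-- Exchange for the descent `i`, applied to a word `ζ ω` of `w`, deletes a letter of `ζ`, which is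
the desired drop in length; a deletion in `ω` would contradict that `ω ++ [i]` is reduced. -/
theorem len_mul_inv_wordProd_of_subset_descents {J : Set I} {w : M.Group}
    (h : J ⊆ M.descents w) {ω : List I} (hω : ∀ i ∈ ω, i ∈ J)
    (hr : M.toCoxeterSystem.IsReduced ω) :
    M.len (w * (M.toCoxeterSystem.wordProd ω)⁻¹) + ω.length = M.len w := by
  induction ω using List.reverseRecOn with
  | nil => simp
  | append_singleton ω i ih =>
    have hr' : M.toCoxeterSystem.IsReduced ω := by simpa using hr.take ω.length
    specialize ih (fun j hj => hω j (by simp [hj])) hr'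
    obtain ⟨ζ, hζ, hz⟩ :=
      M.toCoxeterSystem.exists_isReduced (w * (M.toCoxeterSystem.wordProd ω)⁻¹)
    have hζ' : M.len (w * (M.toCoxeterSystem.wordProd ω)⁻¹) = ζ.length := by
      rw [hz]; exact hζ
    have hw : w = M.toCoxeterSystem.wordProd (ζ ++ ω) := by
      rw [CoxeterSystem.wordProd_append, ← hz]; group
    have hi : i ∈ M.descents w := h (hω i (by simp))
    have hi' := hi
    rw [hw] at hi
    obtain ⟨j, hj, he⟩ := M.exists_eraseIdx_of_mem_descents hi
    rw [← hw] at he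
    rw [List.length_append, List.length_singleton]
    have hlen : M.len (M.toCoxeterSystem.wordProd (ω ++ [i])) = ω.length + 1 := by
      simpa using (show M.len _ = _ from hr)
    rcases lt_or_ge j ζ.length with hjl | hjl
    · rw [List.eraseIdx_append_of_lt_length hjl, CoxeterSystem.wordProd_append] at he
      have h1 : w * (M.toCoxeterSystem.wordProd (ω ++ [i]))⁻¹ =
          M.toCoxeterSystem.wordProd (ζ.eraseIdx j) := by
        rw [wordProd_concat_simple, mul_inv_rev, inv_eq_of_mul_eq_one_left (M.simple_mul_self i),
          ← mul_assoc, he]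
        group
      have h2 := M.len_wordProd_le (ζ.eraseIdx j)
      have h3 := List.length_eraseIdx_add_one hjl
      have h4 := M.len_mul_le (w * (M.toCoxeterSystem.wordProd (ω ++ [i]))⁻¹)
        (M.toCoxeterSystem.wordProd (ω ++ [i]))
      rw [inv_mul_cancel_right, hlen] at h4
      rw [h1] at h4 ⊢
      omega
    · rw [List.eraseIdx_append_of_length_le hjl, CoxeterSystem.wordProd_append, hw,
        CoxeterSystem.wordProd_append, mul_assoc, mul_left_cancel_iff, ← wordProd_concat_simple]
        at he
      rw [List.length_append] at hj
      have h3 := List.length_eraseIdx_add_one (l := ω) (i := j - ζ.length) (by omega)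
      have h2 := M.len_wordProd_le (ω.eraseIdx (j - ζ.length))
      rw [← he] at h2
      omega

theorem len_mul_of_subset_descents {J : Set I} {w y : M.Group} (h : J ⊆ M.descents w)
    (hy : y ∈ M.parabolic J) : M.len (w * y) + M.len y = M.len w := by
  obtain ⟨ω, hJ, hr, he⟩ := M.exists_isReduced_of_mem_parabolic (inv_mem hy)
  have h1 := M.len_mul_inv_wordProd_of_subset_descents h hJ hr
  have h2 : M.len (M.toCoxeterSystem.wordProd ω) = ω.length := hr
  rwa [← h2, he, inv_inv, len_inv] at h1

/-- Repeated exchange represents every element of `w W_J` by a subword of one fixed word of `w`, and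
there are finitely many subwords. -/
theorem isSpherical_of_subset_descents {J : Set I} {w : M.Group} (h : J ⊆ M.descents w) :
    M.IsSpherical J := by
  obtain ⟨ζ, -, hz⟩ := M.toCoxeterSystem.exists_isReduced w
  have key : ∀ ω : List I, (∀ i ∈ ω, i ∈ J) → M.toCoxeterSystem.IsReduced ω →
      ∃ η : List I, η.Sublist ζ ∧
        w * (M.toCoxeterSystem.wordProd ω)⁻¹ = M.toCoxeterSystem.wordProd η := by
    intro ω hω hr
    induction ω with
    | nil => exact ⟨ζ, List.Sublist.refl _, by simpa using hz⟩
    | cons i ω ih =>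
      have hr' : M.toCoxeterSystem.IsReduced ω := by simpa using hr.drop 1
      have hω' : ∀ j ∈ ω, j ∈ J := fun j hj => hω j (by simp [hj])
      obtain ⟨η, hη, he⟩ := ih hω' hr'
      have h1 := M.len_mul_inv_wordProd_of_subset_descents h hω hr
      have h2 := M.len_mul_inv_wordProd_of_subset_descents h hω' hr'
      have h3 : w * (M.toCoxeterSystem.wordProd (i :: ω))⁻¹ =
          M.toCoxeterSystem.wordProd η * M.simple i := by
        rw [wordProd_cons_simple, mul_inv_rev, inv_eq_of_mul_eq_one_left (M.simple_mul_self i),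
          ← mul_assoc, he]
      rw [h3, List.length_cons] at h1
      rw [he] at h2
      obtain ⟨j, -, hj⟩ := M.exists_eraseIdx_of_mem_descents
        (show i ∈ M.descents (M.toCoxeterSystem.wordProd η) by rw [mem_descents]; omega)
      exact ⟨η.eraseIdx j, (List.eraseIdx_sublist _ _).trans hη, h3.trans hj⟩
  have hfin : (M.toCoxeterSystem.wordProd '' {η | η ∈ ζ.sublists}).Finite :=
    (List.finite_toSet _).image _
  refine Set.Finite.to_subtype (s := (M.parabolic J : Set M.Group)) ?_
  refine Set.Finite.of_finite_image (f := fun y => w * y) (hfin.subset ?_)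
    (mul_right_injective w).injOn
  rintro _ ⟨y, hy, rfl⟩
  obtain ⟨ω, hJ, hr, he⟩ := M.exists_isReduced_of_mem_parabolic (inv_mem hy)
  obtain ⟨η, hη, he'⟩ := key ω hJ hr
  rw [he, inv_inv] at he'
  exact ⟨η, List.mem_sublists.mpr hη, he'.symm⟩

/-- Every coset `w W_J` has a representative of minimal length, and lengths add there. -/
theorem exists_minimal_coset_representative (J : Set I) (w : M.Group) :
    ∃ v, ∃ x ∈ M.parabolic J, w = v * x ∧
      ∀ y ∈ M.parabolic J, M.len (v * y) = M.len v + M.len y := by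
  obtain ⟨v, ⟨x, hx, hv⟩, hmin⟩ := exists_minimalFor_of_wellFoundedLT
    (fun v : M.Group => ∃ x ∈ M.parabolic J, w = v * x) M.len ⟨w, 1, one_mem _, by simp⟩
  refine ⟨v, x, hx, hv, ?_⟩
  have hmin' : ∀ z ∈ M.parabolic J, M.len v ≤ M.len (v * z) := by
    intro z hz
    by_contra hlt
    exact hlt (hmin ⟨z⁻¹ * x, mul_mem (inv_mem hz) hx, by rw [hv]; group⟩ (not_le.mp hlt).le)
  have key : ∀ ω : List I, (∀ i ∈ ω, i ∈ J) → M.toCoxeterSystem.IsReduced ω →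
      M.len (v * M.toCoxeterSystem.wordProd ω) = M.len v + ω.length := by
    intro ω hω hr
    induction ω using List.reverseRecOn with
    | nil => simp
    | append_singleton ω i ih =>
      have hr' : M.toCoxeterSystem.IsReduced ω := by simpa using hr.take ω.length
      have hω' : ∀ j ∈ ω, j ∈ J := fun j hj => hω j (by simp [hj])
      specialize ih hω' hr'
      rw [wordProd_concat_simple, List.length_append, List.length_singleton, ← mul_assoc,
        ← add_assoc, ← ih]
      rcases M.mem_ascents_or_mem_descents (v * M.toCoxeterSystem.wordProd ω) i with hi | hi
      · exact hi
      exfalso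
      obtain ⟨ζ, hζ, hz⟩ := M.toCoxeterSystem.exists_isReduced v
      have hζ' : M.len v = ζ.length := by rw [hz]; exact hζ
      have hzω : v * M.toCoxeterSystem.wordProd ω = M.toCoxeterSystem.wordProd (ζ ++ ω) := by
        rw [CoxeterSystem.wordProd_append, ← hz]
      rw [hzω] at hi
      obtain ⟨j, hj, he⟩ := M.exists_eraseIdx_of_mem_descents hi
      rw [← hzω] at he
      rcases lt_or_ge j ζ.length with hjl | hjl
      · rw [List.eraseIdx_append_of_lt_length hjl, CoxeterSystem.wordProd_append] at he
        -- A letter deleted from `ζ` would give an element of `v W_J` shorter than `v`.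
        have hmem : M.toCoxeterSystem.wordProd ω * M.simple i *
            (M.toCoxeterSystem.wordProd ω)⁻¹ ∈ M.parabolic J :=
          mul_mem (mul_mem (M.wordProd_mem_parabolic hω')
            (M.simple_mem_parabolic (hω i (by simp)))) (inv_mem (M.wordProd_mem_parabolic hω'))
        have h1 := hmin' _ hmem
        rw [← mul_assoc, ← mul_assoc, he, mul_inv_cancel_right] at h1
        have h2 := M.len_wordProd_le (ζ.eraseIdx j)
        have h3 := List.length_eraseIdx_add_one hjl
        omega
      · rw [List.eraseIdx_append_of_length_le hjl, CoxeterSystem.wordProd_append, ← hz,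
          mul_assoc, mul_left_cancel_iff, ← wordProd_concat_simple] at he
        rw [List.length_append] at hj
        have h3 := List.length_eraseIdx_add_one (l := ω) (i := j - ζ.length) (by omega)
        have h2 := M.len_wordProd_le (ω.eraseIdx (j - ζ.length))
        have h4 : M.len (M.toCoxeterSystem.wordProd (ω ++ [i])) = ω.length + 1 := by
          simpa using (show M.len _ = _ from hr)
        rw [← he] at h2
        omega
  intro y hy
  obtain ⟨ω, hJ, hr, rfl⟩ := M.exists_isReduced_of_mem_parabolic hy
  rw [key ω hJ hr]
  congr 1
  exact (show M.len _ = _ from hr).symm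

/-- An element with no descent in `J` is its own minimal coset representative: otherwise the last
letter of its `W_J`-part is such a descent. -/
theorem len_mul_of_subset_ascents {J : Set I} {v y : M.Group} (h : J ⊆ M.ascents v)
    (hy : y ∈ M.parabolic J) : M.len (v * y) = M.len v + M.len y := by
  obtain ⟨u, x, hx, rfl, hu⟩ := M.exists_minimal_coset_representative J v
  obtain ⟨ω, hJ, hr, rfl⟩ := M.exists_isReduced_of_mem_parabolic hx
  rcases List.eq_nil_or_concat' ω with rfl | ⟨ω, i, rfl⟩
  · simpa using hu y hy
  · exfalso
    have hi := hJ i (by simp)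
    have h1 := h hi
    have hr' : M.toCoxeterSystem.IsReduced ω := by simpa using hr.take ω.length
    have h2 : M.len _ = _ := hr
    have h3 : M.len _ = _ := hr'
    rw [mem_ascents, mul_assoc, hu _ hx, hu _ (mul_mem hx (M.simple_mem_parabolic hi)),
      h2, wordProd_concat_simple, mul_assoc, simple_mul_self, mul_one, h3,
      List.length_append, List.length_singleton] at h1
    omega

theorem subset_ascents_mul {J : Set I} {v x : M.Group} (h : J ⊆ M.ascents v)
    (hx : x ∈ M.parabolic J) {i : I} (hi : i ∈ J) (hix : i ∈ M.ascents x) :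
    i ∈ M.ascents (v * x) := by
  rw [mem_ascents] at hix ⊢
  rw [mul_assoc, M.len_mul_of_subset_ascents h hx,
    M.len_mul_of_subset_ascents h (mul_mem hx (M.simple_mem_parabolic hi)), hix, add_assoc]

/-! ### The longest element -/

variable {M} {J : Set I}

theorem IsSpherical.longest_spec (h : M.IsSpherical J) :
    M.longest J ∈ M.parabolic J ∧ ∀ v ∈ M.parabolic J, M.len v ≤ M.len (M.longest J) := by
  have : Finite (M.parabolic J) := h
  refine Classical.epsilon_spec
    (p := fun w => w ∈ M.parabolic J ∧ ∀ v ∈ M.parabolic J, M.len v ≤ M.len w) ?_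
  obtain ⟨w, hw⟩ := Finite.exists_max fun w : M.parabolic J => M.len w
  exact ⟨w, w.2, fun v hv => hw ⟨v, hv⟩⟩

theorem IsSpherical.longest_mem (h : M.IsSpherical J) : M.longest J ∈ M.parabolic J :=
  h.longest_spec.1

theorem IsSpherical.subset_descents_longest (h : M.IsSpherical J) :
    J ⊆ M.descents (M.longest J) := by
  intro i hi
  rcases M.mem_ascents_or_mem_descents (M.longest J) i with h' | h'
  · have := h.longest_spec.2 _ (mul_mem h.longest_mem (M.simple_mem_parabolic hi))
    rw [mem_ascents] at h'
    omega
  · exact h'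

theorem IsSpherical.longest_mul_self (h : M.IsSpherical J) : M.longest J * M.longest J = 1 := by
  have := M.len_mul_of_subset_descents h.subset_descents_longest h.longest_mem
  exact M.len_eq_zero_iff.mp (by omega)

theorem IsSpherical.longest_inv (h : M.IsSpherical J) : (M.longest J)⁻¹ = M.longest J :=
  inv_eq_of_mul_eq_one_left h.longest_mul_self

theorem IsSpherical.subset_ascents_of_len_mul_longest (h : M.IsSpherical J) {w : M.Group}
    (hw : M.len (w * M.longest J) = M.len w + M.len (M.longest J)) : J ⊆ M.ascents w := by
  intro i hi
  rcases M.mem_ascents_or_mem_descents w i with h' | h'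
  · exact h'
  exfalso
  have h1 := h.subset_descents_longest hi
  rw [mem_descents] at h1 h'
  have h2 : M.len (M.simple i * M.longest J) = M.len (M.longest J * M.simple i) := by
    rw [← len_inv, mul_inv_rev, h.longest_inv, inv_eq_of_mul_eq_one_left (M.simple_mul_self i)]
  -- If `i` were a descent of `w`, both factors in `w r_J = (w s_i)(s_i r_J)` would be shorter by
  -- one.
  have h3 := M.len_mul_le (w * M.simple i) (M.simple i * M.longest J)
  rw [mul_assoc, ← mul_assoc (M.simple i), simple_mul_self, one_mul] at h3
  omega

theorem IsSpherical.subset_descents_mul_longest (h : M.IsSpherical J) {w : M.Group}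
    (hw : J ⊆ M.ascents w) : J ⊆ M.descents (w * M.longest J) := by
  intro i hi
  have h1 := h.subset_descents_longest hi
  rw [mem_descents] at h1 ⊢
  rw [mul_assoc, M.len_mul_of_subset_ascents hw h.longest_mem,
    M.len_mul_of_subset_ascents hw (mul_mem h.longest_mem (M.simple_mem_parabolic hi)), ← h1,
    add_assoc]

end CoxeterMatrix

/-! ### Alternating products and the Artin–Tits monoid -/

namespace CoxeterMatrix

theorem map_altProd {A C : Type*} [Monoid A] [Monoid C] (f : A →* C) (n : ℕ) (x y : A) :
    f (altProd n x y) = altProd n (f x) (f y) := by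
  induction n generalizing x y with
  | zero => simp [altProd]
  | succ n ih => simp [altProd, ih]

/-- Translates between braid relations and powers of `a * b`, for elements of square one. -/
theorem altProd_eq_pow_mul {G : Type*} [Group G] {a b : G} (ha : a * a = 1) (hb : b * b = 1)
    (n : ℕ) : altProd n a b = (a * b) ^ n * altProd n b a := by
  induction n generalizing a b with
  | zero => simp [altProd]
  | succ n ih =>
    have h : ∀ k : ℕ, a * (b * a) ^ k = (a * b) ^ k * a := by
      intro k
      induction k with
      | zero => simp
      | succ k ihk => rw [pow_succ, ← mul_assoc, ihk, pow_succ]; simp only [mul_assoc]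
    rw [altProd, altProd, ih hb ha, ← mul_assoc, h, pow_succ]
    simp only [mul_assoc]
    rw [← mul_assoc b b, hb, one_mul]

theorem altProd_comm_iff {G : Type*} [Group G] {a b : G} (ha : a * a = 1) (hb : b * b = 1)
    (n : ℕ) : altProd n a b = altProd n b a ↔ (a * b) ^ n = 1 := by
  rw [altProd_eq_pow_mul ha hb, mul_eq_right]

section ArtinMonoid

variable {I : Type*} (M : CoxeterMatrix I)

/-- The canonical morphism from the Artin-Tits monoid to the Coxeter group. -/
def artinToGroup : M.ArtinMonoid →* M.Group :=
  PresentedMonoid.lift M.simple <| by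
    rintro _ _ ⟨i, j, -, rfl, rfl⟩
    rw [map_altProd, map_altProd, FreeMonoid.lift_eval_of, FreeMonoid.lift_eval_of,
      altProd_comm_iff (M.simple_mul_self i) (M.simple_mul_self j)]
    exact M.toCoxeterSystem.simple_mul_simple_pow i j

/-- The length of an element of the Artin-Tits monoid. -/
def artinLen : M.ArtinMonoid →* Multiplicative ℕ :=
  PresentedMonoid.lift (fun _ => Multiplicative.ofAdd 1) <| by
    rintro _ _ ⟨i, j, -, rfl, rfl⟩
    rw [map_altProd, map_altProd, FreeMonoid.lift_eval_of, FreeMonoid.lift_eval_of]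

theorem artinLen_artinGen (i : I) : M.artinLen (M.artinGen i) = Multiplicative.ofAdd 1 := rfl

theorem artinToGroup_toArtin (w : M.Group) : M.artinToGroup (M.toArtin w) = w := by
  have h := (M.toCoxeterSystem.exists_isReduced w).choose_spec.2
  rw [toArtin, map_list_prod, List.map_map]
  exact h.symm

theorem artinLen_toArtin (w : M.Group) :
    M.artinLen (M.toArtin w) = Multiplicative.ofAdd (M.len w) := by
  obtain ⟨h, h'⟩ := (M.toCoxeterSystem.exists_isReduced w).choose_spec
  have h2 : M.len w = (M.toCoxeterSystem.exists_isReduced w).choose.length :=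
    (congrArg M.len h').trans h
  rw [toArtin, map_list_prod, List.map_map, h2,
    show M.artinLen ∘ M.artinGen = fun _ => Multiplicative.ofAdd 1 from
      funext M.artinLen_artinGen,
    List.map_const', List.prod_replicate, ← ofAdd_nsmul]
  simp

end ArtinMonoid

/-- Lengths add in the alternating product `a b a ⋯` with `n` factors. -/
def IsAltReduced {I : Type*} (M : CoxeterMatrix I) (n : ℕ) (a b : M.Group) : Prop :=
  Multiplicative.ofAdd (M.len (altProd n a b)) =
    altProd n (Multiplicative.ofAdd (M.len a)) (Multiplicative.ofAdd (M.len b))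

section IsAltReduced

variable {I : Type*} {M : CoxeterMatrix I} {a b : M.Group} {n : ℕ}

theorem ofAdd_len_altProd_le (n : ℕ) (a b : M.Group) :
    Multiplicative.ofAdd (M.len (altProd n a b)) ≤
      altProd n (Multiplicative.ofAdd (M.len a)) (Multiplicative.ofAdd (M.len b)) := by
  induction n generalizing a b with
  | zero => simp [altProd, len_one]
  | succ n ih =>
    rw [altProd, altProd]
    refine le_trans ?_ (mul_le_mul_right (ih b a) _)
    exact M.len_mul_le _ _

/-- The total length is at most additive at each factor, so equality overall forces equality at
every stage. Removing the first factor exchanges the roles of `a` and `b`. -/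
theorem IsAltReduced.of_succ (h : M.IsAltReduced (n + 1) a b) :
    M.IsAltReduced n b a ∧ M.len (a * altProd n b a) = M.len a + M.len (altProd n b a) := by
  rw [IsAltReduced, altProd, altProd] at h
  have h1 := ofAdd_len_altProd_le n b a
  have h2 := M.len_mul_le a (altProd n b a)
  rw [IsAltReduced]
  generalize altProd n (Multiplicative.ofAdd (M.len b)) (Multiplicative.ofAdd (M.len a)) = x at *
  have h' : M.len (a * altProd n b a) = M.len a + x.toAdd := h
  have h1' : M.len (altProd n b a) ≤ x.toAdd := h1
  have h3 : M.len (altProd n b a) = x.toAdd := by omega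
  exact ⟨congrArg Multiplicative.ofAdd h3, by omega⟩

theorem IsAltReduced.of_le (h : M.IsAltReduced n a b) (h' : M.IsAltReduced n b a) {k : ℕ}
    (hk : k ≤ n) : M.IsAltReduced k a b ∧ M.IsAltReduced k b a := by
  induction n with
  | zero => rw [Nat.le_zero.mp hk]; exact ⟨h, h'⟩
  | succ n ih =>
    rcases Nat.le_succ_iff.mp hk with hk | rfl
    · exact ih h'.of_succ.1 h.of_succ.1 hk
    · exact ⟨h, h'⟩

end IsAltReduced

/-! ### Dihedral parabolic subgroups -/

section Dihedral

variable {I : Type*} (M : CoxeterMatrix I)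

theorem wordProd_alternatingWord (i j : I) (k : ℕ) :
    M.toCoxeterSystem.wordProd (CoxeterSystem.alternatingWord i j k) =
      (altProd k (M.simple j) (M.simple i))⁻¹ := by
  induction k generalizing i j with
  | zero => simp [altProd, CoxeterSystem.alternatingWord]
  | succ k ih =>
    rw [CoxeterSystem.alternatingWord_succ, List.concat_eq_append, wordProd_concat_simple, ih,
      altProd, mul_inv_rev, inv_eq_of_mul_eq_one_left (M.simple_mul_self j)]

theorem eq_alternatingWord_of_isReduced {i j : I} {ω : List I} (hω : ∀ k ∈ ω, k = i ∨ k = j)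
    (hr : M.toCoxeterSystem.IsReduced (ω ++ [i])) :
    ω = CoxeterSystem.alternatingWord i j ω.length := by
  induction ω using List.reverseRecOn generalizing i j with
  | nil => rfl
  | append_singleton ω k ih =>
    have hr' : M.toCoxeterSystem.IsReduced (ω ++ [k]) := by
      have := hr.take (ω ++ [k]).length
      rwa [List.take_left] at this
    have hki : k ≠ i := by
      rintro rfl
      have h1 : M.len _ = _ := hr
      rw [wordProd_concat_simple, wordProd_concat_simple, mul_assoc, simple_mul_self, mul_one] at h1
      have := M.len_wordProd_le ω
      simp at h1
      omega
    obtain rfl : k = j := (hω k (by simp)).resolve_left hki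
    rw [List.length_append, List.length_singleton, CoxeterSystem.alternatingWord_succ,
      List.concat_eq_append, ← ih (fun l hl => (hω l (by simp [hl])).symm) hr']

/-- As `i` is an ascent, a reduced word of `x` stays reduced with `i` appended, so it alternates and
ends in `j` when non-empty. The bound on `k` is strict because the appended letter also counts
towards `M i j`. -/
theorem eq_inv_altProd_of_mem_parabolic_pair {i j : I} {x : M.Group}
    (hx : x ∈ M.parabolic {i, j}) (hi : i ∈ M.ascents x) :
    ∃ k, (M i j ≠ 0 → k < M i j) ∧ x = (altProd k (M.simple j) (M.simple i))⁻¹ := by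
  obtain ⟨ω, hω, hr, rfl⟩ := M.exists_isReduced_of_mem_parabolic hx
  have h1 : M.len _ = _ := hr
  have hr' : M.toCoxeterSystem.IsReduced (ω ++ [i]) := by
    change M.len _ = _
    rw [mem_ascents] at hi
    rw [wordProd_concat_simple, hi, h1]
    simp
  have he := M.eq_alternatingWord_of_isReduced (fun k hk => by simpa using hω k hk) hr'
  refine ⟨ω.length, ?_, ?_⟩
  · intro h0
    by_contra hlt
    rw [he, ← List.concat_eq_append, ← CoxeterSystem.alternatingWord_succ] at hr'
    refine M.toCoxeterSystem.not_isReduced_alternatingWord j i ?_ ?_ hr'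
    · rwa [M.symmetric]
    · rw [M.symmetric]; omega
  · rw [← wordProd_alternatingWord, ← he]

end Dihedral

/-! ### LCM-partitions -/

section LCMPartition

variable {I : Type*} {M : CoxeterMatrix I} {P : Set (Set I)} {Ω : CoxeterMatrix P}

theorem IsLCMPartition.isSpherical (h : M.IsLCMPartition P Ω) (α : P) :
    M.IsSpherical (α : Set I) := h.1.2 α α.2

theorem IsLCMPartition.nonempty (h : M.IsLCMPartition P Ω) (α : P) : (α : Set I).Nonempty :=
  Setoid.nonempty_of_mem_partition h.1.1 α.2

/-- Both parts are images of the identity of (Fi): one in the Coxeter group, the other under the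
length morphism. -/
theorem IsLCMPartition.longest_union (h : M.IsLCMPartition P Ω) {α β : P} (h0 : Ω α β ≠ 0) :
    M.longest ((α : Set I) ∪ β) = altProd (Ω α β) (M.longest (α : Set I)) (M.longest (β : Set I)) ∧
      M.IsAltReduced (Ω α β) (M.longest (α : Set I)) (M.longest (β : Set I)) := by
  obtain ⟨-, -, he⟩ | ⟨h0', -⟩ := h.2 α β
  · have h1 := congrArg M.artinToGroup he
    have h2 := congrArg M.artinLen he
    simp only [map_altProd, artinLongest, artinToGroup_toArtin, artinLen_toArtin] at h1 h2
    refine ⟨h1, ?_⟩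
    rw [IsAltReduced, ← h1, h2]
  · exact absurd h0' h0

theorem IsLCMPartition.longest_mul_longest_pow (h : M.IsLCMPartition P Ω) (α β : P) :
    (M.longest (α : Set I) * M.longest (β : Set I)) ^ Ω α β = 1 := by
  by_cases h0 : Ω α β = 0
  · rw [h0, pow_zero]
  · rw [← altProd_comm_iff (h.isSpherical α).longest_mul_self (h.isSpherical β).longest_mul_self,
      ← (h.longest_union h0).1, Set.union_comm, (h.longest_union (Ω.symmetric α β ▸ h0)).1,
      Ω.symmetric β α]

theorem IsLCMPartition.subset_ascents_inv_altProd (h : M.IsLCMPartition P Ω) (α β : P) {k : ℕ}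
    (hk : Ω α β ≠ 0 → k < Ω α β) :
    (α : Set I) ⊆
      M.ascents (altProd k (M.longest (β : Set I)) (M.longest (α : Set I)))⁻¹ := by
  by_cases h0 : Ω α β = 0
  -- Case (In): all of `β` becomes descents after multiplication by `r_β`, so a descent `i ∈ α`
  -- would make `{i} ∪ β` spherical.
  · clear hk
    induction k generalizing α β with
    | zero =>
      intro i _
      simpa [altProd] using M.mem_ascents_one i
    | succ k ih =>
      intro i hi
      have h1 := ih β α (by rwa [Ω.symmetric])
      rw [altProd, mul_inv_rev, (h.isSpherical β).longest_inv]
      refine (M.mem_ascents_or_mem_descents _ i).resolve_right fun hd => ?_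
      obtain ⟨h0', -⟩ | ⟨-, hn⟩ := h.2 α β
      · exact h0' h0
      · refine hn i hi (M.isSpherical_of_subset_descents (Set.union_subset ?_
          ((h.isSpherical β).subset_descents_mul_longest h1)))
        exact Set.singleton_subset_iff.mpr hd
  · apply (h.isSpherical α).subset_ascents_of_len_mul_longest
    have h1 := (h.longest_union h0).2
    have h2 := (h.longest_union (α := β) (β := α) (Ω.symmetric α β ▸ h0)).2
    rw [Ω.symmetric β α] at h2
    -- Case (Fi): `k < Ω α β` leaves room for one more factor `r_α`, with lengths still adding.
    have h3 := ((h1.of_le h2 (hk h0)).1).of_succ.2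
    rw [← M.len_inv (_ * _), mul_inv_rev, inv_inv, (h.isSpherical α).longest_inv, h3, len_inv,
      add_comm]

theorem IsLCMPartition.orderOf_longest_mul_longest (h : M.IsLCMPartition P Ω) (α β : P) :
    orderOf (M.longest (α : Set I) * M.longest (β : Set I)) = Ω α β := by
  have key : ∀ k, 0 < k → (Ω α β ≠ 0 → k < Ω α β) →
      (M.longest (α : Set I) * M.longest (β : Set I)) ^ k ≠ 1 := by
    intro k hk0 hk he
    rw [← altProd_comm_iff (h.isSpherical α).longest_mul_self
      (h.isSpherical β).longest_mul_self] at he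
    obtain ⟨i, hi⟩ := h.nonempty α
    have h1 := h.subset_ascents_inv_altProd α β hk hi
    obtain ⟨k, rfl⟩ := Nat.exists_eq_succ_of_ne_zero hk0.ne'
    -- By the supposed relation, the same element is also an alternating product ending in `r_α`,
    -- which has `α` among its descents.
    rw [← he, altProd, mul_inv_rev, (h.isSpherical α).longest_inv] at h1
    refine M.notMem_descents_of_mem_ascents h1
      ((h.isSpherical α).subset_descents_mul_longest ?_ hi)
    exact h.subset_ascents_inv_altProd α β fun h0 => (Nat.lt_succ_self k).trans (hk h0)
  by_cases h0 : Ω α β = 0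
  · rw [h0, orderOf_eq_zero_iff']
    exact fun k hk => key k hk fun h0' => absurd h0 h0'
  · rw [orderOf_eq_iff (Nat.pos_of_ne_zero h0)]
    exact ⟨h.longest_mul_longest_pow α β, fun k hk hk0 => key k hk0 fun _ => hk⟩

/-- The morphism of Coxeter groups `s_α ↦ r_α` induced by an LCM-partition. -/
noncomputable def IsLCMPartition.groupHom (h : M.IsLCMPartition P Ω) : Ω.Group →* M.Group :=
  Ω.toCoxeterSystem.lift ⟨fun α => M.longest (α : Set I), h.longest_mul_longest_pow⟩

theorem IsLCMPartition.groupHom_simple (h : M.IsLCMPartition P Ω) (α : P) :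
    h.groupHom (Ω.simple α) = M.longest (α : Set I) := by
  rw [← toCoxeterSystem_simple]
  exact Ω.toCoxeterSystem.lift_apply_simple h.longest_mul_longest_pow α

theorem IsLCMPartition.groupHom_mem_parabolic (h : M.IsLCMPartition P Ω) {Q : Set P} {J : Set I}
    (hJ : ∀ α ∈ Q, (α : Set I) ⊆ J) {x : Ω.Group} (hx : x ∈ Ω.parabolic Q) :
    h.groupHom x ∈ M.parabolic J := by
  have hle : Ω.parabolic Q ≤ (M.parabolic J).comap h.groupHom := by
    rw [parabolic, Subgroup.closure_le]
    rintro _ ⟨α, hα, rfl⟩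
    rw [SetLike.mem_coe, Subgroup.mem_comap, h.groupHom_simple]
    exact M.parabolic_mono (hJ α hα) (h.isSpherical α).longest_mem
  exact hle hx

theorem IsLCMPartition.subset_ascents_groupHom (h : M.IsLCMPartition P Ω) {u : Ω.Group} {α : P}
    (hα : α ∈ Ω.ascents u) : (α : Set I) ⊆ M.ascents (h.groupHom u) := by
  induction hn : Ω.len u using Nat.strong_induction_on generalizing u α with
  | _ n ih =>
    by_cases hu : u = 1
    · rw [hu, map_one]
      exact fun i _ => M.mem_ascents_one i
    obtain ⟨β, hβ⟩ : ∃ β, β ∈ Ω.descents u := by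
      obtain ⟨β, hβ⟩ := Ω.toCoxeterSystem.exists_rightDescent_of_ne_one hu
      refine ⟨β, (Ω.mem_ascents_or_mem_descents u β).resolve_left fun h' => ?_⟩
      rw [CoxeterSystem.IsRightDescent, toCoxeterSystem_simple] at hβ
      change Ω.len _ < Ω.len _ at hβ
      rw [mem_ascents] at h'
      omega
    -- Taking `β` to be a descent of `u` ensures `x ≠ 1`, hence that `v` is shorter than `u`.
    obtain ⟨v, x, hx, rfl, hv⟩ := Ω.exists_minimal_coset_representative {α, β} u
    have hmem : ∀ γ ∈ ({α, β} : Set P), Ω.simple γ ∈ Ω.parabolic {α, β} :=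
      fun γ hγ => Ω.simple_mem_parabolic hγ
    have hv1 : ∀ γ ∈ ({α, β} : Set P), γ ∈ Ω.ascents v := by
      intro γ hγ
      rw [mem_ascents, hv _ (hmem γ hγ), ← toCoxeterSystem_simple]
      congr 1
      exact Ω.toCoxeterSystem.length_simple γ
    have hx1 : x ≠ 1 := by
      rintro rfl
      rw [mul_one] at hβ
      exact Ω.notMem_descents_of_mem_ascents (hv1 β (by simp)) hβ
    have hlt : Ω.len v < n := by
      have := hv x hx
      have := mt Ω.len_eq_zero_iff.mp hx1
      omega
    have hαx : α ∈ Ω.ascents x := by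
      rw [mem_ascents, mul_assoc, hv _ hx, hv _ (mul_mem hx (hmem α (by simp)))] at hα
      rw [mem_ascents]
      omega
    obtain ⟨k, hk, hxk⟩ := Ω.eq_inv_altProd_of_mem_parabolic_pair hx hαx
    have hsub : (α : Set I) ⊆ M.ascents (h.groupHom x) := by
      rw [hxk, map_inv, map_altProd, h.groupHom_simple, h.groupHom_simple]
      exact h.subset_ascents_inv_altProd α β hk
    intro i hi
    rw [map_mul]
    refine M.subset_ascents_mul (J := (α : Set I) ∪ β) (Set.union_subset ?_ ?_)
      (h.groupHom_mem_parabolic ?_ hx) (Or.inl hi) (hsub hi)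
    · exact ih _ hlt (hv1 α (by simp)) rfl
    · exact ih _ hlt (hv1 β (by simp)) rfl
    · rintro γ (rfl | rfl)
      exacts [Set.subset_union_left, Set.subset_union_right]

theorem IsLCMPartition.isAdmissiblePartition (h : M.IsLCMPartition P Ω) :
    M.IsAdmissiblePartition P := by
  refine ⟨h.1, fun w hw α hα => ?_⟩
  obtain ⟨u, rfl⟩ : w ∈ h.groupHom.range := by
    refine (Subgroup.closure_le _).mpr ?_ hw
    rintro _ ⟨β, hβ, rfl⟩
    exact ⟨Ω.simple ⟨β, hβ⟩, h.groupHom_simple ⟨β, hβ⟩⟩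
  rcases Ω.mem_ascents_or_mem_descents u ⟨α, hα⟩ with h1 | h1
  · exact Or.inl (h.subset_ascents_groupHom h1)
  · right
    have h2 : (⟨α, hα⟩ : P) ∈ Ω.ascents (u * Ω.simple ⟨α, hα⟩) := by
      rw [mem_descents] at h1
      rw [mem_ascents, mul_assoc, simple_mul_self, mul_one, h1]
    have h3 := (h.isSpherical ⟨α, hα⟩).subset_descents_mul_longest (h.subset_ascents_groupHom h2)
    rwa [← h.groupHom_simple, ← map_mul, mul_assoc, simple_mul_self, mul_one] at h3

theorem IsLCMPartition.eq_partitionType (h : M.IsLCMPartition P Ω) :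
    Ω.M = M.partitionType P := by
  ext α β
  exact (h.orderOf_longest_mul_longest α β).symm

end LCMPartition

end CoxeterMatrix

theorem theorem3p11 {I : Type*} (M : CoxeterMatrix I) :
    (∀ (P : Set (Set I)) (Ω : CoxeterMatrix P), M.IsLCMPartition P Ω →
      M.IsAdmissiblePartition P ∧ Ω.M = M.partitionType P) ∧
    (∀ (J : Set I) (P : Set (Set J)) (Ω : CoxeterMatrix P)
      (φ : Ω.ArtinMonoid →* M.ArtinMonoid),
      M.IsLCMHomomorphism φ → M.IsAdmissibleMorphism φ) :=
  ⟨fun _ _ h => ⟨h.isAdmissiblePartition, h.eq_partitionType⟩,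
    fun _ _ _ _ h => ⟨h.1.isAdmissiblePartition, h.1.eq_partitionType, h.2⟩⟩
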